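/- Let $J:\mathbb{R}\to\mathbb{R}$ be a nonnegative, even, $C^\infty$ function with $\int_{\mathbb{R}}J=1$ that decays rapidly at infinity, i.e. $\sup_{x}|x|^kJ(x)<\infty$ for every integer $k\ge 0$, and let $u_0\in L^1(\mathbb{R})\cap L^\infty(\mathbb{R})$ be real-valued. The problem $$u_t(x,t)=\int_{\mathbb{R}}J(x-y)\,\bigl(u(y,t)-u(x,t)\bigr)\,dy\quad(x\in\mathbb{R},\ t>0),\qquad u(x,0)=u_0(x),$$ has exactly one solution $u$ that, as a function of time, is continuous on $[0,\infty)$ and differentiable on $(0,\infty)$ with values in $L^1(\mathbb{R})$. It satisfies, for every $p\in[1,\infty]$, $$\lim_{t\to\infty}t^{\frac12\left(1-\frac1p\right)}\,\|u(t)-M\,G_{At}\|_{L^p(\mathbb{R})}=0,$$ where $G_t(x)=\frac{1}{\sqrt{4\pi t}}\exp\left(-\frac{x^2}{4t}\right)$ is the heat kernel, $M=\int_{\mathbb{R}}u_0(x)\,dx$ and $A=\frac12\int_{\mathbb{R}}J(z)z^2\,dz$. -/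

import Mathlib

open MeasureTheory Filter Topology Set
open scoped ENNReal ContDiff

noncomputable section

namespace NonlocalDiffusion

/-- `J` decays at infinity faster than every power of `1 / |x|`. -/
def RapidlyDecaying (J : ℝ → ℝ) : Prop :=
  ∀ k : ℕ, ∃ C : ℝ, ∀ x : ℝ, |x| ^ k * |J x| ≤ C

/-- The heat kernel `G_t(x) = (4πt)^{-1/2} exp(-x² / (4t))`. -/
def heatKernel (t x : ℝ) : ℝ :=
  1 / Real.sqrt (4 * Real.pi * t) * Real.exp (-(x ^ 2 / (4 * t)))

/-- The right-hand side of the equation, `x ↦ ∫ J(x - y) (f(y) - f(x)) dy`. -/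
def nonlocalOp (J f : ℝ → ℝ) (x : ℝ) : ℝ :=
  ∫ y, J (x - y) * (f y - f x)

/-- `u` solves `u_t(x,t) = ∫ J(x - y) (u(y,t) - u(x,t)) dy` for `t > 0`, `u(·,0) = u₀`,
as a function of time with values in `L¹(ℝ)`: it is continuous on `[0, ∞)`, differentiable on
`(0, ∞)`, and satisfies the equation and the initial condition almost everywhere in `x`.
The values `u t` with `t < 0` play no role. -/
structure IsSolution (J u₀ : ℝ → ℝ) (u : ℝ → Lp ℝ 1 (volume : Measure ℝ)) : Prop where
  continuousOn : ContinuousOn u (Ici 0)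
  initial : u 0 =ᵐ[volume] u₀
  equation : ∀ t : ℝ, 0 < t → ∃ u' : Lp ℝ 1 (volume : Measure ℝ),
    HasDerivAt u u' t ∧ u' =ᵐ[volume] nonlocalOp J (u t)

end NonlocalDiffusion

end

/-!
The equation is `u' = J * u - u`, a linear ODE in `L¹(ℝ)` with a bounded generator, so its exponential
provides a solution. For each frequency `ξ` the Fourier transform of a solution satisfies a scalar
ODE, hence `û(t, ξ) = exp(-t m(ξ)) û₀(ξ)` with the real symbol `m = 1 - Ĵ`
(`IsSolution.realFourier_eq`), and injectivity of the Fourier transform gives uniqueness.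

For the asymptotics, `m(ξ) = 4π² A ξ² + O(ξ⁴)` at the origin, and `m` is bounded below by a positive
constant away from it (`IsKernel.exists_symbol_ge`). The solution keeps the singular part
`exp(-t) u₀`, but the transform of `u(t) - exp(-t) u₀` is dominated by `t |Ĵ û₀|`. Although `Ĵ` itself
need not be integrable (nothing is assumed about the derivatives of `J`), this product is, since
`J` and `u₀` lie in `L²`. Scaling `ξ = η / √t` and dominated convergence then give
`√t ∫ |û(t, ξ) - exp(-t) û₀(ξ) - M exp(-4π² A t ξ²)| dξ → 0`
(`IsKernel.tendsto_integral_profileError`), which is the `L^∞` statement after Fourier inversion.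

The `L¹` statement follows from the uniform one without any weighted estimate. For `u₀ ≥ 0` the
evolution being an `L¹` contraction yields `‖u(t)‖₁ ≤ M = ‖M G_{At}‖₁`, and a quantitative Scheffé
lemma (`integral_abs_sub_le_of_ae_le`) bounds the `L¹` distance by the uniform distance `ε` through
`√ε ∫ √(M G_{At}) = O(√(ε √t))`. General data are split into positive and negative parts, and the
remaining `p` are obtained by interpolating between `1` and `∞`.
-/

noncomputable section

namespace NonlocalDiffusion

section

open FourierTransform SchwartzMap

/-! ### Fourier analysis on `L¹` and `L²` -/

lemma ae_eq_of_forall_schwartz {f h : ℝ → ℂ} (hf : LocallyIntegrable f) (hh : LocallyIntegrable h)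
    (H : ∀ g : 𝓢(ℝ, ℂ), ∫ x, g x * f x = ∫ x, g x * h x) : f =ᵐ[volume] h := by
  refine ae_eq_of_integral_contDiff_smul_eq hf hh fun g hg hgs => ?_
  have hgs' : HasCompactSupport (fun x => (g x : ℂ)) :=
    hgs.comp_left (g := fun r : ℝ => (r : ℂ)) Complex.ofReal_zero
  have hg' : ContDiff ℝ ∞ (fun x => (g x : ℂ)) := Complex.ofRealCLM.contDiff.comp hg
  simpa using H (hgs'.toSchwartzMap hg')

lemma integral_schwartz_mul_fourier {f : ℝ → ℂ} (hf : Integrable f) (g : 𝓢(ℝ, ℂ)) :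
    ∫ x, g x * 𝓕 f x = ∫ x, (𝓕 g) x * f x := by
  have := VectorFourier.integral_fourierIntegral_smul_eq_flip (μ := volume) (ν := volume)
    (L := innerₗ ℝ) Real.continuous_fourierChar (by fun_prop) hf g.integrable
  rw [flip_innerₗ] at this
  simp only [smul_eq_mul] at this
  simp_rw [mul_comm (g _), SchwartzMap.fourier_coe, mul_comm _ (f _)]
  exact this

lemma continuous_fourier {f : ℝ → ℂ} (hf : Integrable f) : Continuous (𝓕 f) :=
  VectorFourier.fourierIntegral_continuous Real.continuous_fourierChar
    (innerSL ℝ).continuous₂ hf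

/-- The Fourier integral of a function in `L¹ ∩ L²` is square integrable: it agrees with the
`L²` Fourier transform, both having the same pairing with every Schwartz function. -/
lemma memLp_two_fourier {f : ℝ → ℂ} (hf : Integrable f) (hf2 : MemLp f 2) : MemLp (𝓕 f) 2 := by
  set F : Lp ℂ 2 (volume : Measure ℝ) := 𝓕 hf2.toLp
  have hFf : F =ᵐ[volume] 𝓕 f := by
    refine ae_eq_of_forall_schwartz ((Lp.memLp F).locallyIntegrable (by norm_num))
      (continuous_fourier hf).locallyIntegrable fun g => ?_
    rw [integral_schwartz_mul_fourier hf]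
    have h := DFunLike.congr_fun (Lp.fourier_toTemperedDistribution_eq hf2.toLp) g
    rw [TemperedDistribution.fourier_apply, Lp.toTemperedDistribution_apply,
      Lp.toTemperedDistribution_apply] at h
    refine h.symm.trans (integral_congr_ae ?_)
    filter_upwards [hf2.coeFn_toLp] with x hx
    rw [hx, smul_eq_mul]
  exact (memLp_congr_ae hFf).1 (Lp.memLp F)

/-- Fourier inversion almost everywhere, with no continuity assumption on `f`. -/
lemma ae_eq_fourierInv_fourier {f : ℝ → ℂ} (hf : Integrable f) (hF : Integrable (𝓕 f)) :
    f =ᵐ[volume] 𝓕⁻ (𝓕 f) := by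
  have hF' : Integrable (fun x => 𝓕 f (-x)) := hF.comp_neg
  have hInv : 𝓕⁻ (𝓕 f) = 𝓕 (fun x => 𝓕 f (-x)) := Real.fourierInv_eq_fourier_comp_neg _
  refine ae_eq_of_forall_schwartz hf.locallyIntegrable ?_ fun g => ?_
  · rw [hInv]; exact (continuous_fourier hF').locallyIntegrable
  · have h1 := integral_schwartz_mul_fourier hf (𝓕⁻ g)
    rw [FourierTransform.fourier_fourierInv_eq] at h1
    have h2 := integral_neg_eq_self (fun x => (𝓕 g) x * 𝓕 f (-x)) volume
    rw [← h1, hInv, integral_schwartz_mul_fourier hF' g, ← h2]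
    congr with x
    rw [neg_neg]
    rw [SchwartzMap.fourierInv_coe, SchwartzMap.fourier_coe, Real.fourierInv_eq_fourier_neg]

lemma ae_norm_le_integral_fourier {f : ℝ → ℂ} (hf : Integrable f) (hF : Integrable (𝓕 f)) :
    ∀ᵐ x, ‖f x‖ ≤ ∫ ξ, ‖𝓕 f ξ‖ := by
  filter_upwards [ae_eq_fourierInv_fourier hf hF] with x hx
  rw [hx, Real.fourierInv_eq]
  refine (norm_integral_le_integral_norm _).trans_eq ?_
  simp_rw [Circle.norm_smul]

lemma ae_eq_zero_of_fourier_eq_zero {f : ℝ → ℂ} (hf : Integrable f) (hF : ∀ ξ, 𝓕 f ξ = 0) :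
    f =ᵐ[volume] 0 := by
  have h0 : 𝓕 f = 0 := funext hF
  filter_upwards [ae_norm_le_integral_fourier hf (by rw [h0]; exact integrable_zero _ _ _)] with x hx
  simpa [h0] using hx

end

section

open FourierTransform Convolution

/-! ### The generator on `L¹` and its semigroup -/

/-- The Fourier transform `f̂(ξ) = ∫ exp(-2πixξ) f(x) dx` of a real-valued function. -/
def realFourier (f : ℝ → ℝ) (ξ : ℝ) : ℂ := 𝓕 (fun x => (f x : ℂ)) ξ

lemma realFourier_congr_ae {f g : ℝ → ℝ} (h : f =ᵐ[volume] g) (ξ : ℝ) :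
    realFourier f ξ = realFourier g ξ :=
  Real.fourier_congr_ae (h.mono fun x hx => by simp [hx]) ξ

lemma continuous_realFourier {f : ℝ → ℝ} (hf : Integrable f) : Continuous (realFourier f) :=
  continuous_fourier hf.ofReal

lemma realFourier_eq (f : ℝ → ℝ) (ξ : ℝ) :
    realFourier f ξ = ∫ x, Complex.exp (↑(-2 * Real.pi * x * ξ) * Complex.I) * f x := by
  rw [realFourier, Real.fourier_real_eq_integral_exp_smul]
  rfl

lemma norm_realFourier_le (f : ℝ → ℝ) (ξ : ℝ) : ‖realFourier f ξ‖ ≤ ∫ x, |f x| := by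
  rw [realFourier_eq]
  refine (norm_integral_le_integral_norm _).trans_eq ?_
  simp_rw [norm_mul, Complex.norm_exp_ofReal_mul_I, one_mul, Complex.norm_real, Real.norm_eq_abs]

lemma realFourier_zero (f : ℝ → ℝ) : realFourier f 0 = ((∫ x, f x : ℝ) : ℂ) := by
  rw [realFourier_eq]
  simpa using integral_ofReal (𝕜 := ℂ) (f := f)

lemma realFourier_sub {f g : ℝ → ℝ} (hf : Integrable f) (hg : Integrable g) (ξ : ℝ) :
    realFourier (fun x => f x - g x) ξ = realFourier f ξ - realFourier g ξ := by
  have key : ∀ {f : ℝ → ℝ}, Integrable f →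
      Integrable (fun x : ℝ => Complex.exp (↑(-2 * Real.pi * x * ξ) * Complex.I) * f x) := by
    intro f hf
    refine hf.ofReal.bdd_mul (c := 1) (Continuous.aestronglyMeasurable (by fun_prop)) ?_
    exact ae_of_all _ fun x => (Complex.norm_exp_ofReal_mul_I _).le
  simp_rw [realFourier_eq]
  rw [← integral_sub (key hf) (key hg)]
  congr with x
  push_cast; ring

lemma realFourier_const_mul (c : ℝ) (f : ℝ → ℝ) (ξ : ℝ) :
    realFourier (fun x => c * f x) ξ = c * realFourier f ξ := by
  simp_rw [realFourier_eq]
  rw [← integral_const_mul]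
  congr with x
  push_cast; ring

lemma convolution_eq_integral (J f : ℝ → ℝ) (x : ℝ) :
    (J ⋆[ContinuousLinearMap.lsmul ℝ ℝ] f) x = ∫ y, J (x - y) * f y := by
  rw [convolution_lsmul_swap]; rfl

lemma integrable_conv {J f : ℝ → ℝ} (hJ : Integrable J) (hf : Integrable f) :
    Integrable (fun x => ∫ y, J (x - y) * f y) := by
  simpa only [← convolution_eq_integral] using!
    hJ.integrable_convolution (ContinuousLinearMap.lsmul ℝ ℝ) hf

lemma integral_conv {J f : ℝ → ℝ} (hJ : Integrable J) (hf : Integrable f) :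
    ∫ x, ∫ y, J (x - y) * f y = (∫ x, J x) * ∫ x, f x := by
  simp only [← convolution_eq_integral]
  exact integral_convolution (ContinuousLinearMap.lsmul ℝ ℝ) hJ hf

lemma realFourier_conv {J f : ℝ → ℝ} (hJ : Integrable J) (hf : Integrable f) (ξ : ℝ) :
    realFourier (fun x => ∫ y, J (x - y) * f y) ξ = realFourier J ξ * realFourier f ξ := by
  have h := Real.fourier_mul_convolution_eq (R := ℂ) hJ.ofReal hf.ofReal ξ
  rw [realFourier, realFourier, realFourier]
  refine Eq.trans (Real.fourier_congr_ae (ae_of_all _ fun x => ?_) ξ) h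
  rw [convolution_mul_swap]
  exact (integral_ofReal (𝕜 := ℂ)).symm.trans (by simp)

lemma integral_abs_conv_le {J f : ℝ → ℝ} (hJ : Integrable J) (hf : Integrable f) :
    ∫ x, |∫ y, J (x - y) * f y| ≤ (∫ x, |J x|) * ∫ x, |f x| := by
  rw [← integral_conv hJ.abs hf.abs]
  refine integral_mono (integrable_conv hJ hf).abs (integrable_conv hJ.abs hf.abs) fun x => ?_
  simpa only [← abs_mul] using abs_integral_le_integral_abs

/-- Convolution with an integrable `J`, as a bounded operator on `L¹(ℝ)`. -/
def convOp (J : ℝ → ℝ) (hJ : Integrable J) :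
    Lp ℝ 1 (volume : Measure ℝ) →L[ℝ] Lp ℝ 1 (volume : Measure ℝ) :=
  LinearMap.mkContinuous
    { toFun := fun f => (integrable_conv hJ (L1.integrable_coeFn f)).toL1
      map_add' := fun f g => by
        rw [← Integrable.toL1_add, Integrable.toL1_eq_toL1_iff]
        filter_upwards [hJ.ae_convolution_exists (ContinuousLinearMap.lsmul ℝ ℝ)
            (L1.integrable_coeFn f),
          hJ.ae_convolution_exists (ContinuousLinearMap.lsmul ℝ ℝ)
            (L1.integrable_coeFn g)] with x hf hg
        rw [Pi.add_apply, ← integral_add (by simpa using hf.integrable_swap)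
          (by simpa using hg.integrable_swap)]
        refine integral_congr_ae ?_
        filter_upwards [Lp.coeFn_add f g] with y hy
        rw [hy, Pi.add_apply, mul_add]
      map_smul' := fun c f => by
        rw [RingHom.id_apply, ← Integrable.toL1_smul, Integrable.toL1_eq_toL1_iff]
        refine ae_of_all _ fun x => ?_
        simp only [smul_eq_mul, ← integral_const_mul]
        refine integral_congr_ae ?_
        filter_upwards [Lp.coeFn_smul c f] with y hy
        rw [hy, Pi.smul_apply, smul_eq_mul]; ring }
    (∫ x, |J x|) fun f => by
      simp only [LinearMap.coe_mk, AddHom.coe_mk]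
      rw [L1.norm_eq_integral_norm f, L1.norm_of_fun_eq_integral_norm]
      exact integral_abs_conv_le hJ (L1.integrable_coeFn f)

lemma coeFn_convOp {J : ℝ → ℝ} (hJ : Integrable J) (f : Lp ℝ 1 (volume : Measure ℝ)) :
    convOp J hJ f =ᵐ[volume] fun x => ∫ y, J (x - y) * f y :=
  Integrable.coeFn_toL1 (integrable_conv hJ (L1.integrable_coeFn f))

lemma norm_convOp_le {J : ℝ → ℝ} (hJ : Integrable J) : ‖convOp J hJ‖ ≤ ∫ x, |J x| :=
  LinearMap.mkContinuous_norm_le _ (integral_nonneg fun _ => abs_nonneg _) _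

/-- The value at the frequency `ξ` of the Fourier transform, as a functional on real `L¹(ℝ)`. -/
def fourierAt (ξ : ℝ) : Lp ℝ 1 (volume : Measure ℝ) →L[ℝ] ℂ :=
  ((BoundedContinuousFunction.evalCLM ℂ ξ).restrictScalars ℝ ∘L
    (Real.Lp.fourierTransformCLM ℝ ℂ).restrictScalars ℝ) ∘L
      Complex.ofRealCLM.compLpL 1 volume

lemma fourierAt_apply (ξ : ℝ) (f : Lp ℝ 1 (volume : Measure ℝ)) :
    fourierAt ξ f = realFourier f ξ := by
  refine Real.fourier_congr_ae ?_ ξ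
  exact Complex.ofRealCLM.coeFn_compLpL f

end

/-- The generator `f ↦ J * f - f` of the evolution, as a bounded operator on `L¹(ℝ)`. -/
def generator (J : ℝ → ℝ) (hJ : Integrable J) :
    Lp ℝ 1 (volume : Measure ℝ) →L[ℝ] Lp ℝ 1 (volume : Measure ℝ) :=
  convOp J hJ - 1

lemma coeFn_generator {J : ℝ → ℝ} (hJ : Integrable J) (hJ_int : ∫ x, J x = 1)
    (f : Lp ℝ 1 (volume : Measure ℝ)) :
    generator J hJ f =ᵐ[volume] nonlocalOp J f := by
  filter_upwards [Lp.coeFn_sub (convOp J hJ f) f, coeFn_convOp hJ f,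
    hJ.ae_convolution_exists (ContinuousLinearMap.lsmul ℝ ℝ) (L1.integrable_coeFn f)]
    with x h1 h2 h3
  have h4 : (generator J hJ f) x = (convOp J hJ f) x - f x := h1
  rw [h4, h2, nonlocalOp]
  simp_rw [mul_sub]
  rw [integral_sub (by simpa using h3.integrable_swap) ((hJ.comp_sub_left x).mul_const _),
    integral_mul_const, integral_sub_left_eq_self J volume x, hJ_int, one_mul]

lemma fourierAt_generator {J : ℝ → ℝ} (hJ : Integrable J) (ξ : ℝ)
    (f : Lp ℝ 1 (volume : Measure ℝ)) :
    fourierAt ξ (generator J hJ f) = (realFourier J ξ - 1) * fourierAt ξ f := by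
  have h : generator J hJ f = convOp J hJ f - f := rfl
  rw [h, map_sub, fourierAt_apply, fourierAt_apply, realFourier_congr_ae (coeFn_convOp hJ f),
    realFourier_conv hJ (L1.integrable_coeFn f)]
  ring

lemma isSolution_exp {J : ℝ → ℝ} (hJ : Integrable J) (hJ_int : ∫ x, J x = 1)
    (f : Lp ℝ 1 (volume : Measure ℝ)) :
    IsSolution J f (fun t => NormedSpace.exp (t • generator J hJ) f) := by
  have hd : ∀ t : ℝ, HasDerivAt (fun t : ℝ => NormedSpace.exp (t • generator J hJ) f)
      (generator J hJ (NormedSpace.exp (t • generator J hJ) f)) t := fun t =>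
    (hasDerivAt_exp_smul_const' (𝕂 := ℝ) (generator J hJ) t).clm_apply (hasDerivAt_const t f)
      |>.congr_deriv (by simp)
  refine ⟨fun t _ => (hd t).continuousAt.continuousWithinAt, by simp, fun t _ =>
    ⟨_, hd t, coeFn_generator hJ hJ_int _⟩⟩

lemma norm_exp_le_exp_norm {𝔸 : Type*} [NormedRing 𝔸] [NormedAlgebra ℝ 𝔸]
    (h1 : ‖(1 : 𝔸)‖ ≤ 1) (x : 𝔸) : ‖NormedSpace.exp x‖ ≤ Real.exp ‖x‖ := by
  rw [NormedSpace.exp_eq_tsum ℝ, Real.exp_eq_exp_ℝ]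
  refine tsum_of_norm_bounded (NormedSpace.expSeries_div_hasSum_exp ‖x‖) fun n => ?_
  rw [norm_smul, norm_inv, Real.norm_natCast, inv_mul_eq_div]
  gcongr
  rcases n.eq_zero_or_pos with rfl | hn
  · simpa using h1
  · exact norm_pow_le' x hn

/-- The semigroup generated by `f ↦ J * f - f` is a contraction of `L¹(ℝ)`. -/
lemma norm_exp_generator_le {J : ℝ → ℝ} (hJ : Integrable J) (hJ_nonneg : ∀ x, 0 ≤ J x)
    (hJ_int : ∫ x, J x = 1) {t : ℝ} (ht : 0 ≤ t) :
    ‖NormedSpace.exp (t • generator J hJ)‖ ≤ 1 := by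
  have hT : ‖convOp J hJ‖ ≤ 1 := by
    refine (norm_convOp_le hJ).trans_eq ?_
    simp_rw [abs_of_nonneg (hJ_nonneg _), hJ_int]
  have hsplit : t • generator J hJ = t • convOp J hJ + algebraMap ℝ _ (-t) := by
    rw [generator, smul_sub, Algebra.algebraMap_eq_smul_one, neg_smul, sub_eq_add_neg]
  let : NormedAlgebra ℚ (Lp ℝ 1 (volume : Measure ℝ) →L[ℝ] Lp ℝ 1 (volume : Measure ℝ)) :=
    NormedAlgebra.restrictScalars ℚ ℝ _
  rw [hsplit, NormedSpace.exp_add_of_commute (Algebra.commutes _ _).symm,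
    ← NormedSpace.algebraMap_exp_comm, ← Real.exp_eq_exp_ℝ]
  calc _ ≤ ‖NormedSpace.exp (t • convOp J hJ)‖ * ‖algebraMap ℝ _ (Real.exp (-t))‖ :=
        norm_mul_le _ _
    _ ≤ Real.exp t * Real.exp (-t) := by
        gcongr
        · refine (norm_exp_le_exp_norm ContinuousLinearMap.norm_id_le _).trans (Real.exp_le_exp.2 ?_)
          rw [norm_smul, Real.norm_of_nonneg ht]
          exact mul_le_of_le_one_right ht hT
        · rw [Algebra.algebraMap_eq_smul_one]
          refine (norm_smul_le _ _).trans ?_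
          rw [Real.norm_of_nonneg (Real.exp_pos _).le]
          exact mul_le_of_le_one_right (Real.exp_pos _).le ContinuousLinearMap.norm_id_le
    _ = 1 := by rw [← Real.exp_add]; simp

lemma eq_initial_of_hasDerivAt_zero {h : ℝ → ℂ} (hc : ContinuousOn h (Ici 0))
    (hd : ∀ t, 0 < t → HasDerivAt h 0 t) {t : ℝ} (ht : 0 ≤ t) : h t = h 0 := by
  rcases ht.eq_or_lt with rfl | ht
  · rfl
  have hs : ∀ᶠ s in 𝓝[>] (0 : ℝ), h s = h t := by
    filter_upwards [Ioo_mem_nhdsGT ht] with s hs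
    refine (constant_of_has_deriv_right_zero (a := s) (b := t) (hc.mono fun r hr => ?_)
      (fun r hr => (hd r (hs.1.trans_le hr.1)).hasDerivWithinAt) t ⟨hs.2.le, le_rfl⟩).symm
    exact hs.1.le.trans hr.1
  have h0 : Tendsto h (𝓝[>] 0) (𝓝 (h 0)) :=
    (hc 0 self_mem_Ici).mono_left (nhdsWithin_mono _ Ioi_subset_Ici_self)
  exact tendsto_nhds_unique (tendsto_const_nhds.congr' (hs.mono fun _ h => h.symm)) h0

/-- In frequency variables the equation is a linear scalar ODE for each `ξ`. -/
lemma IsSolution.realFourier_eq {J u₀ : ℝ → ℝ} (hJ : Integrable J) (hJ_int : ∫ x, J x = 1)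
    {u : ℝ → Lp ℝ 1 (volume : Measure ℝ)} (hu : IsSolution J u₀ u) (ξ : ℝ) {t : ℝ} (ht : 0 ≤ t) :
    realFourier (u t) ξ = Complex.exp (t * (realFourier J ξ - 1)) * realFourier u₀ ξ := by
  set m := realFourier J ξ - 1 with hm
  have hexp : ∀ s : ℝ, HasDerivAt (fun s : ℝ => Complex.exp (-(s * m)))
      (Complex.exp (-(s * m)) * (-m)) s := fun s => by
    have h1 : HasDerivAt (fun s : ℝ => (s : ℂ)) 1 s := Complex.ofRealCLM.hasDerivAt
    simpa using (h1.mul_const m).neg.cexp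
  have h := eq_initial_of_hasDerivAt_zero
    (h := fun s : ℝ => Complex.exp (-(s * m)) * fourierAt ξ (u s)) ?_ ?_ ht
  · simp only [Complex.ofReal_zero, zero_mul, neg_zero, Complex.exp_zero, one_mul] at h
    rw [fourierAt_apply, fourierAt_apply, realFourier_congr_ae hu.initial, Complex.exp_neg,
      inv_mul_eq_iff_eq_mul₀ (Complex.exp_ne_zero _)] at h
    exact h
  · exact ContinuousOn.mul (fun s _ => (hexp s).continuousAt.continuousWithinAt)
      ((fourierAt ξ).continuous.comp_continuousOn hu.continuousOn)
  · intro s hs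
    obtain ⟨u', hu', he⟩ := hu.equation s hs
    have hgen : u' = generator J hJ (u s) := by
      ext1
      exact he.trans (coeFn_generator hJ hJ_int (u s)).symm
    have h2 := (fourierAt ξ).hasFDerivAt.comp_hasDerivAt s hu'
    refine ((hexp s).mul h2).congr_deriv ?_
    rw [hgen, fourierAt_generator, ← hm]
    simp only [Function.comp_apply]
    ring

lemma IsSolution.unique {J u₀ : ℝ → ℝ} (hJ : Integrable J) (hJ_int : ∫ x, J x = 1)
    {u v : ℝ → Lp ℝ 1 (volume : Measure ℝ)} (hu : IsSolution J u₀ u) (hv : IsSolution J u₀ v)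
    {t : ℝ} (ht : 0 ≤ t) : u t = v t := by
  ext1
  have hi := L1.integrable_coeFn (u t)
  have hi' := L1.integrable_coeFn (v t)
  have h : (fun x => ((u t x - v t x : ℝ) : ℂ)) =ᵐ[volume] 0 :=
    ae_eq_zero_of_fourier_eq_zero (hi.sub hi').ofReal fun ξ => by
      have := realFourier_sub hi hi' ξ
      rw [hu.realFourier_eq hJ hJ_int ξ ht, hv.realFourier_eq hJ hJ_int ξ ht, sub_self] at this
      exact this
  filter_upwards [h] with x hx
  exact sub_eq_zero.1 (Complex.ofReal_eq_zero.1 hx)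

section

/-! ### The symbol of the generator -/

/-- The properties of the jump density used below: a symmetric probability density in `L²(ℝ)` with
finite second and fourth moments. -/
structure IsKernel (J : ℝ → ℝ) : Prop where
  nonneg : ∀ x, 0 ≤ J x
  even : ∀ x, J (-x) = J x
  integrable : Integrable J
  integral_eq_one : ∫ x, J x = 1
  memLp_two : MemLp J 2
  integrable_sq : Integrable fun x => J x * x ^ 2
  integrable_four : Integrable fun x => J x * x ^ 4

/-- The function `m(ξ) = ∫ J(x) (1 - cos(2πxξ)) dx`; the generator acts in frequency variables as
multiplication by `-m`. -/
def symbol (J : ℝ → ℝ) (ξ : ℝ) : ℝ := ∫ x, J x * (1 - Real.cos (2 * Real.pi * x * ξ))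

/-- The diffusivity `A = ½ ∫ J(z) z² dz`. -/
def diffusivity (J : ℝ → ℝ) : ℝ := 1 / 2 * ∫ z, J z * z ^ 2

variable {J : ℝ → ℝ}

lemma IsKernel.integrable_mul_cos (hJ : IsKernel J) (ξ : ℝ) :
    Integrable fun x => J x * Real.cos (2 * Real.pi * x * ξ) :=
  hJ.integrable.mul_bdd (c := 1) (Continuous.aestronglyMeasurable (by fun_prop))
    (ae_of_all _ fun x => Real.abs_cos_le_one _)

lemma IsKernel.integrable_mul_one_sub_cos (hJ : IsKernel J) (ξ : ℝ) :
    Integrable fun x => J x * (1 - Real.cos (2 * Real.pi * x * ξ)) := by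
  simp_rw [mul_sub, mul_one]
  exact hJ.integrable.sub (hJ.integrable_mul_cos ξ)

lemma IsKernel.symbol_eq (hJ : IsKernel J) (ξ : ℝ) :
    symbol J ξ = 1 - ∫ x, J x * Real.cos (2 * Real.pi * x * ξ) := by
  simp_rw [symbol, mul_sub, mul_one]
  rw [integral_sub hJ.integrable (hJ.integrable_mul_cos ξ), hJ.integral_eq_one]

lemma IsKernel.realFourier_eq (hJ : IsKernel J) (ξ : ℝ) :
    realFourier J ξ = ((1 - symbol J ξ : ℝ) : ℂ) := by
  have hint : ∀ ξ : ℝ, Integrable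
      (fun x : ℝ => Complex.exp (↑(-2 * Real.pi * x * ξ) * Complex.I) * J x) := fun ξ =>
    hJ.integrable.ofReal.bdd_mul (c := 1) (Continuous.aestronglyMeasurable (by fun_prop))
      (ae_of_all _ fun x => (Complex.norm_exp_ofReal_mul_I _).le)
  have h1 : realFourier J ξ = realFourier J (-ξ) := by
    rw [NonlocalDiffusion.realFourier_eq, NonlocalDiffusion.realFourier_eq,
      ← integral_neg_eq_self]
    congr with x
    rw [hJ.even]
    congr 3
    push_cast; ring
  have h2 : realFourier J ξ + realFourier J (-ξ) =
      2 * ((∫ x, J x * Real.cos (2 * Real.pi * x * ξ) : ℝ) : ℂ) := by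
    rw [NonlocalDiffusion.realFourier_eq, NonlocalDiffusion.realFourier_eq,
      ← integral_add (hint ξ) (hint (-ξ)), ← integral_complex_ofReal, ← integral_const_mul]
    congr with x
    push_cast
    rw [Complex.cos]
    ring_nf
  rw [← h1, ← two_mul] at h2
  rw [mul_left_cancel₀ two_ne_zero h2, hJ.symbol_eq, sub_sub_cancel]

lemma IsKernel.continuous_symbol (hJ : IsKernel J) : Continuous (symbol J) := by
  have h : symbol J = fun ξ => 1 - (realFourier J ξ).re := by
    funext ξ; rw [hJ.realFourier_eq, Complex.ofReal_re, sub_sub_cancel]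
  rw [h]
  exact continuous_const.sub (Complex.continuous_re.comp (continuous_realFourier hJ.integrable))

lemma IsKernel.not_ae_eq_zero (hJ : IsKernel J) : ¬ J =ᵐ[volume] 0 := fun h => by
  have := hJ.integral_eq_one
  rw [integral_congr_ae h] at this
  simp at this

lemma IsKernel.symbol_nonneg (hJ : IsKernel J) (ξ : ℝ) : 0 ≤ symbol J ξ :=
  integral_nonneg fun x => mul_nonneg (hJ.nonneg x) (sub_nonneg.2 (Real.cos_le_one _))

/-- `cos(2πxξ) = 1` only for countably many `x`, so that `m(ξ) = 0` would force `J = 0` almost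
everywhere. -/
lemma IsKernel.symbol_pos (hJ : IsKernel J) {ξ : ℝ} (hξ : ξ ≠ 0) : 0 < symbol J ξ := by
  refine (hJ.symbol_nonneg ξ).lt_of_ne fun h => hJ.not_ae_eq_zero ?_
  have h0 := (integral_eq_zero_iff_of_nonneg
    (fun x => mul_nonneg (hJ.nonneg x) (sub_nonneg.2 (Real.cos_le_one _)))
    (hJ.integrable_mul_one_sub_cos ξ)).1 h.symm
  have hc : (range fun n : ℤ => (n : ℝ) / ξ).Countable := countable_range _
  filter_upwards [h0, hc.ae_notMem volume] with x hx hn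
  refine (mul_eq_zero.1 hx).resolve_right fun hcos => hn ?_
  obtain ⟨n, hn⟩ := (Real.cos_eq_one_iff _).1 (sub_eq_zero.1 hcos).symm
  refine ⟨n, ?_⟩
  rw [div_eq_iff hξ]
  have := Real.pi_pos
  apply mul_right_cancel₀ (show (2 * Real.pi) ≠ 0 by positivity)
  rw [hn]; ring

lemma IsKernel.diffusivity_pos (hJ : IsKernel J) : 0 < diffusivity J := by
  refine mul_pos (by norm_num) ?_
  refine (integral_nonneg fun x => mul_nonneg (hJ.nonneg x) (sq_nonneg x)).lt_of_ne
    fun h => hJ.not_ae_eq_zero ?_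
  have h0 := (integral_eq_zero_iff_of_nonneg
    (fun x => mul_nonneg (hJ.nonneg x) (sq_nonneg x)) hJ.integrable_sq).1 h.symm
  filter_upwards [h0, (countable_singleton (0 : ℝ)).ae_notMem volume] with x hx hn
  exact (mul_eq_zero.1 hx).resolve_right (pow_ne_zero 2 hn)

lemma abs_one_sub_cos_sub_le (s : ℝ) : |1 - Real.cos s - s ^ 2 / 2| ≤ 5 / 2 * s ^ 4 := by
  rcases le_total |s| 1 with h | h
  · have h1 := Real.cos_bound h
    rw [abs_sub_comm, show |s| ^ 4 = s ^ 4 from (by decide : Even 4).pow_abs s] at h1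
    rw [show 1 - Real.cos s - s ^ 2 / 2 = 1 - s ^ 2 / 2 - Real.cos s by ring]
    nlinarith [sq_nonneg (s ^ 2)]
  · have h1 : 1 ≤ s ^ 2 := by rw [← sq_abs]; nlinarith
    rw [abs_le]
    constructor <;> nlinarith [Real.neg_one_le_cos s, Real.cos_le_one s]

/-- The symbol is quadratic to leading order at the origin. -/
lemma IsKernel.exists_abs_symbol_sub_le (hJ : IsKernel J) :
    ∃ C, 0 < C ∧ ∀ ξ, |symbol J ξ - 4 * Real.pi ^ 2 * diffusivity J * ξ ^ 2| ≤ C * ξ ^ 4 := by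
  have h4 : 0 ≤ ∫ x, J x * x ^ 4 :=
    integral_nonneg fun x => mul_nonneg (hJ.nonneg x) (by positivity)
  refine ⟨5 / 2 * (2 * Real.pi) ^ 4 * (∫ x, J x * x ^ 4) + 1, by positivity, fun ξ => ?_⟩
  have h1 : symbol J ξ - 4 * Real.pi ^ 2 * diffusivity J * ξ ^ 2 = ∫ x, J x *
      (1 - Real.cos (2 * Real.pi * x * ξ) - (2 * Real.pi * x * ξ) ^ 2 / 2) := by
    have h2 : 4 * Real.pi ^ 2 * diffusivity J * ξ ^ 2 =
        ∫ x, (2 * Real.pi ^ 2 * ξ ^ 2) * (J x * x ^ 2) := by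
      rw [integral_const_mul, diffusivity]; ring
    rw [h2, symbol, ← integral_sub (hJ.integrable_mul_one_sub_cos ξ)
      (hJ.integrable_sq.const_mul _)]
    congr with x
    ring
  rw [h1]
  calc _ ≤ ∫ x, 5 / 2 * (2 * Real.pi) ^ 4 * ξ ^ 4 * (J x * x ^ 4) := by
        refine abs_integral_le_integral_abs.trans (integral_mono_of_nonneg
          (ae_of_all _ fun _ => abs_nonneg _) (hJ.integrable_four.const_mul _)
          (ae_of_all _ fun x => ?_))
        dsimp only
        rw [abs_mul, abs_of_nonneg (hJ.nonneg x)]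
        refine (mul_le_mul_of_nonneg_left (abs_one_sub_cos_sub_le _) (hJ.nonneg x)).trans_eq ?_
        ring
    _ ≤ _ := by
        rw [integral_const_mul]
        nlinarith [sq_nonneg (ξ ^ 2)]

lemma IsKernel.exists_symbol_ge_sq (hJ : IsKernel J) :
    ∃ c δ, 0 < c ∧ 0 < δ ∧ ∀ ξ, |ξ| ≤ δ → c * ξ ^ 2 ≤ symbol J ξ := by
  obtain ⟨C, hC, h⟩ := hJ.exists_abs_symbol_sub_le
  have hA := hJ.diffusivity_pos
  have hpi := Real.pi_pos
  set a := 2 * Real.pi ^ 2 * diffusivity J with ha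
  have ha0 : 0 < a := by positivity
  refine ⟨a, √(a / C), ha0, Real.sqrt_pos.2 (by positivity), fun ξ hξ => ?_⟩
  have h1 : ξ ^ 2 ≤ a / C := by
    rw [← sq_abs, ← Real.sq_sqrt (show 0 ≤ a / C by positivity)]
    gcongr
  rw [le_div_iff₀ hC] at h1
  have h2 := (abs_le.1 (h ξ)).1
  have h3 : 4 * Real.pi ^ 2 * diffusivity J * ξ ^ 2 = 2 * (a * ξ ^ 2) := by rw [ha]; ring
  rw [h3] at h2
  nlinarith [mul_le_mul_of_nonneg_left h1 (sq_nonneg ξ)]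

/-- Away from the origin the symbol is bounded below: it is positive and continuous, and tends to
`1` at infinity by the Riemann-Lebesgue lemma. -/
lemma IsKernel.exists_symbol_ge (hJ : IsKernel J) {δ : ℝ} (hδ : 0 < δ) :
    ∃ κ, 0 < κ ∧ κ ≤ 1 ∧ ∀ ξ, δ ≤ |ξ| → κ ≤ symbol J ξ := by
  have hlim : Tendsto (symbol J) (cocompact ℝ) (𝓝 1) := by
    have h : symbol J = fun ξ => 1 - (realFourier J ξ).re := by
      funext ξ; rw [hJ.realFourier_eq, Complex.ofReal_re, sub_sub_cancel]
    rw [h]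
    have h0 : Tendsto (realFourier J) (cocompact ℝ) (𝓝 0) :=
      Real.zero_at_infty_fourier fun x => (J x : ℂ)
    simpa using ((Complex.continuous_re.tendsto 0).comp h0).const_sub 1
  have hev : ∀ᶠ ξ in cocompact ℝ, 1 / 2 ≤ symbol J ξ :=
    hlim.eventually (eventually_ge_nhds (by norm_num))
  obtain ⟨K, hK, hKs⟩ := mem_cocompact.1 hev
  have hcl : IsClosed {ξ : ℝ | δ ≤ |ξ|} := isClosed_le continuous_const continuous_abs
  have hcpt := hK.inter_right hcl
  rcases (K ∩ {ξ : ℝ | δ ≤ |ξ|}).eq_empty_or_nonempty with he | hne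
  · refine ⟨1 / 2, by norm_num, by norm_num, fun ξ hξ => hKs fun hmem => ?_⟩
    exact (he ▸ (⟨hmem, hξ⟩ : ξ ∈ K ∩ {ξ : ℝ | δ ≤ |ξ|}) : ξ ∈ (∅ : Set ℝ))
  · obtain ⟨ξ₀, hξ₀, hmin⟩ := hcpt.exists_isMinOn hne hJ.continuous_symbol.continuousOn
    have hpos : 0 < symbol J ξ₀ := hJ.symbol_pos (abs_pos.1 (hδ.trans_le hξ₀.2))
    refine ⟨min (1 / 2) (symbol J ξ₀), lt_min (by norm_num) hpos,
      (min_le_left _ _).trans (by norm_num), fun ξ hξ => ?_⟩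
    by_cases hmem : ξ ∈ K
    · exact (min_le_right _ _).trans (hmin ⟨hmem, hξ⟩)
    · exact (min_le_left _ _).trans (hKs hmem)

end

section

/-! ### Convergence in frequency variables -/

/-- The Fourier transform of `u(t) - exp(-t) u₀ - M G_{At}`, where `F` is the Fourier transform of
`u₀`, so that `M = F 0`. -/
def profileError (J : ℝ → ℝ) (F : ℝ → ℂ) (t ξ : ℝ) : ℂ :=
  ((Real.exp (-(t * symbol J ξ)) - Real.exp (-t) : ℝ) : ℂ) * F ξ -
    (Real.exp (-(4 * Real.pi ^ 2 * diffusivity J * t * ξ ^ 2)) : ℂ) * F 0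

lemma abs_exp_sub_exp_le {a b c : ℝ} (ha : a ≤ c) (hb : b ≤ c) :
    |Real.exp a - Real.exp b| ≤ |a - b| * Real.exp c := by
  wlog h : b ≤ a generalizing a b
  · rw [abs_sub_comm, abs_sub_comm a]
    exact this hb ha (le_of_not_ge h)
  have h1 : Real.exp b = Real.exp a * Real.exp (b - a) := by rw [← Real.exp_add]; ring_nf
  have h2 := Real.add_one_le_exp (b - a)
  have h3 := Real.exp_le_exp.2 ha
  rw [abs_of_nonneg (sub_nonneg.2 (Real.exp_le_exp.2 h)), abs_of_nonneg (sub_nonneg.2 h)]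
  nlinarith [Real.exp_pos a]

variable {J : ℝ → ℝ} {F : ℝ → ℂ}

lemma abs_exp_symbol_sub_le {κ : ℝ} (hκ : κ ≤ 1) {ξ t : ℝ}
    (hξ : κ ≤ symbol J ξ) (ht : 0 ≤ t) :
    |Real.exp (-(t * symbol J ξ)) - Real.exp (-t)| ≤
      t * Real.exp (-(κ * t)) * |1 - symbol J ξ| := by
  refine (abs_exp_sub_exp_le (c := -(κ * t)) (by nlinarith) (by nlinarith)).trans_eq ?_
  rw [show -(t * symbol J ξ) - -t = t * (1 - symbol J ξ) by ring, abs_mul, abs_of_nonneg ht]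
  ring

lemma IsKernel.memLp_two_one_sub_symbol (hJ : IsKernel J) :
    MemLp (fun ξ => 1 - symbol J ξ) 2 := by
  refine (memLp_two_fourier hJ.integrable.ofReal hJ.memLp_two.ofReal).re.congr_norm ?_ ?_
  · exact (continuous_const.sub hJ.continuous_symbol).aestronglyMeasurable
  · refine ae_of_all _ fun ξ => ?_
    have := hJ.realFourier_eq ξ
    rw [realFourier] at this
    simp [this]

lemma IsKernel.integrable_one_sub_symbol_mul (hJ : IsKernel J) (hF : MemLp F 2) :
    Integrable fun ξ => |1 - symbol J ξ| * ‖F ξ‖ :=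
  hJ.memLp_two_one_sub_symbol.norm.integrable_mul hF.norm

lemma integrable_exp_neg_mul_sq_mul {a : ℝ} (ha : 0 < a) (z : ℂ) :
    Integrable fun ξ : ℝ => (Real.exp (-(a * ξ ^ 2)) : ℂ) * z := by
  have := (integrable_exp_neg_mul_sq ha).ofReal (𝕜 := ℂ)
  simp only [neg_mul] at this
  exact this.mul_const z

lemma IsKernel.integrable_profileError (hJ : IsKernel J) (hFc : Continuous F) (hF : MemLp F 2)
    {t : ℝ} (ht : 0 < t) : Integrable (profileError J F t) := by
  have hA := hJ.diffusivity_pos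
  have hs := hJ.continuous_symbol
  have hpi := Real.pi_pos
  refine Integrable.sub ?_ (integrable_exp_neg_mul_sq_mul (by positivity) _)
  refine ((hJ.integrable_one_sub_symbol_mul hF).const_mul t).mono'
    (Continuous.aestronglyMeasurable (by fun_prop)) (ae_of_all _ fun ξ => ?_)
  rw [norm_mul, Complex.norm_real, Real.norm_eq_abs, ← mul_assoc]
  gcongr
  simpa using abs_exp_symbol_sub_le zero_le_one (hJ.symbol_nonneg ξ) ht.le

/-- Diffusive scaling turns the symbol into that of the Laplacian. -/
lemma IsKernel.tendsto_mul_symbol (hJ : IsKernel J) (η : ℝ) :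
    Tendsto (fun t : ℝ => t * symbol J (η / √t)) atTop
      (𝓝 (4 * Real.pi ^ 2 * diffusivity J * η ^ 2)) := by
  obtain ⟨C, hC, hquad⟩ := hJ.exists_abs_symbol_sub_le
  rw [tendsto_iff_norm_sub_tendsto_zero]
  refine squeeze_zero' (Eventually.of_forall fun _ => norm_nonneg _) ?_
    (tendsto_const_nhds (x := C * η ^ 4).div_atTop tendsto_id)
  filter_upwards [eventually_gt_atTop 0] with t ht
  have h1 := hquad (η / √t)
  have h4 : √t ^ 4 = t ^ 2 := by
    rw [show √t ^ 4 = (√t ^ 2) ^ 2 by ring, Real.sq_sqrt ht.le]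
  have h2 : t * symbol J (η / √t) - 4 * Real.pi ^ 2 * diffusivity J * η ^ 2 =
      t * (symbol J (η / √t) - 4 * Real.pi ^ 2 * diffusivity J * (η / √t) ^ 2) := by
    rw [div_pow, Real.sq_sqrt ht.le]; field_simp
  rw [h2, norm_mul, Real.norm_of_nonneg ht.le, Real.norm_eq_abs]
  refine (mul_le_mul_of_nonneg_left h1 ht.le).trans_eq ?_
  rw [div_pow, h4, id]; field_simp

lemma tendsto_div_sqrt (η : ℝ) : Tendsto (fun t : ℝ => η / √t) atTop (𝓝 0) :=
  Real.tendsto_sqrt_atTop.const_div_atTop η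

lemma IsKernel.tendsto_scaled_sub (hJ : IsKernel J) (hFc : Continuous F) (η : ℝ) :
    Tendsto (fun t : ℝ => (Real.exp (-(t * symbol J (η / √t))) : ℂ) * F (η / √t) -
      (Real.exp (-(4 * Real.pi ^ 2 * diffusivity J * η ^ 2)) : ℂ) * F 0) atTop (𝓝 0) := by
  have h1 : Tendsto (fun t : ℝ => (Real.exp (-(t * symbol J (η / √t))) : ℂ)) atTop
      (𝓝 (Real.exp (-(4 * Real.pi ^ 2 * diffusivity J * η ^ 2)) : ℂ)) :=
    (Complex.continuous_ofReal.tendsto _).comp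
      ((Real.continuous_exp.tendsto _).comp (hJ.tendsto_mul_symbol η).neg)
  have h2 : Tendsto (fun t : ℝ => F (η / √t)) atTop (𝓝 (F 0)) :=
    (hFc.tendsto 0).comp (tendsto_div_sqrt η)
  have h3 := (h1.mul h2).sub_const
    ((Real.exp (-(4 * Real.pi ^ 2 * diffusivity J * η ^ 2)) : ℂ) * F 0)
  rwa [sub_self] at h3

/-- The low-frequency part of the error after the scaling `ξ = η / √t`. -/
lemma IsKernel.tendsto_low_frequency (hJ : IsKernel J) (hFc : Continuous F) {B : ℝ}
    (hB : ∀ ξ, ‖F ξ‖ ≤ B) {c δ : ℝ} (hc : 0 < c) (hδ : 0 < δ)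
    (hcδ : ∀ ξ, |ξ| ≤ δ → c * ξ ^ 2 ≤ symbol J ξ) :
    Tendsto (fun t : ℝ => √t * ∫ ξ, ‖(Icc (-δ) δ).indicator
      (fun ξ => (Real.exp (-(t * symbol J ξ)) : ℂ) * F ξ) ξ -
        (Real.exp (-(4 * Real.pi ^ 2 * diffusivity J * t * ξ ^ 2)) : ℂ) * F 0‖) atTop (𝓝 0) := by
  have hA := hJ.diffusivity_pos
  have hs := hJ.continuous_symbol
  have hpi := Real.pi_pos
  have hB0 : 0 ≤ B := (norm_nonneg _).trans (hB 0)
  set a := 4 * Real.pi ^ 2 * diffusivity J with ha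
  have ha0 : 0 < a := by positivity
  let Φ : ℝ → ℝ → ℝ := fun t η => ‖(Icc (-δ) δ).indicator
      (fun ξ => (Real.exp (-(t * symbol J ξ)) : ℂ) * F ξ) (η / √t) -
        (Real.exp (-(a * η ^ 2)) : ℂ) * F 0‖
  have hscale : ∀ᶠ t : ℝ in atTop, ∫ η, Φ t η = √t * ∫ ξ, ‖(Icc (-δ) δ).indicator
      (fun ξ => (Real.exp (-(t * symbol J ξ)) : ℂ) * F ξ) ξ -
        (Real.exp (-(a * t * ξ ^ 2)) : ℂ) * F 0‖ := by
    filter_upwards [eventually_gt_atTop 0] with t ht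
    have hst : 0 < √t := Real.sqrt_pos.2 ht
    have := Measure.integral_comp_div (fun ξ => ‖(Icc (-δ) δ).indicator
      (fun ξ => (Real.exp (-(t * symbol J ξ)) : ℂ) * F ξ) ξ -
        (Real.exp (-(a * t * ξ ^ 2)) : ℂ) * F 0‖) (√t)
    rw [abs_of_pos hst, smul_eq_mul] at this
    rw [← this]
    congr with η
    have : a * t * (η / √t) ^ 2 = a * η ^ 2 := by
      rw [div_pow, Real.sq_sqrt ht.le]; field_simp
    rw [this]
  refine Tendsto.congr' hscale ?_
  have hzero : (0 : ℝ) = ∫ _ : ℝ, (0 : ℝ) := by simp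
  rw [hzero]
  refine tendsto_integral_filter_of_dominated_convergence
    (fun η => (Real.exp (-c * η ^ 2) + Real.exp (-a * η ^ 2)) * B) ?_ ?_ ?_ ?_
  · refine Eventually.of_forall fun t => Measurable.aestronglyMeasurable ?_
    have hm : Measurable ((Icc (-δ) δ).indicator
        (fun ξ => (Real.exp (-(t * symbol J ξ)) : ℂ) * F ξ)) :=
      (Continuous.measurable (by fun_prop)).indicator measurableSet_Icc
    exact ((hm.comp (measurable_id.div_const _)).sub
      (Continuous.measurable (by fun_prop))).norm
  · filter_upwards [eventually_gt_atTop 0] with t ht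
    refine ae_of_all _ fun η => ?_
    have hst : 0 < √t := Real.sqrt_pos.2 ht
    rw [norm_norm, add_mul]
    refine (norm_sub_le _ _).trans (add_le_add ?_ ?_)
    · by_cases hη : η / √t ∈ Icc (-δ) δ
      · rw [indicator_of_mem hη, norm_mul, Complex.norm_real, Real.norm_of_nonneg (Real.exp_pos _).le]
        gcongr
        · have h1 := hcδ _ (abs_le.2 hη)
          rw [div_pow, Real.sq_sqrt ht.le, mul_div_assoc', div_le_iff₀ ht] at h1
          linarith
        · exact hB _
      · rw [indicator_of_notMem hη, norm_zero]
        positivity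
    · rw [norm_mul, Complex.norm_real, Real.norm_of_nonneg (Real.exp_pos _).le, neg_mul]
      gcongr
      exact hB 0
  · exact ((integrable_exp_neg_mul_sq hc).add (integrable_exp_neg_mul_sq ha0)).mul_const B
  · refine ae_of_all _ fun η => ?_
    have hin : ∀ᶠ t : ℝ in atTop, η / √t ∈ Icc (-δ) δ :=
      (tendsto_div_sqrt η).eventually (Icc_mem_nhds (by linarith) hδ)
    have := (hJ.tendsto_scaled_sub hFc η).norm
    rw [norm_zero] at this
    refine this.congr' ?_
    filter_upwards [hin] with t ht
    simp only [Φ]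
    rw [indicator_of_mem ht]

lemma tendsto_sqrt_mul_exp_neg {κ : ℝ} (hκ : 0 < κ) (n : ℕ) :
    Tendsto (fun t : ℝ => √t * (t ^ n * Real.exp (-(κ * t)))) atTop (𝓝 0) := by
  have h := tendsto_rpow_mul_exp_neg_mul_atTop_nhds_zero (1 / 2 + n) κ hκ
  refine h.congr' ?_
  filter_upwards [eventually_gt_atTop 0] with t ht
  rw [Real.rpow_add ht, Real.sqrt_eq_rpow, Real.rpow_natCast, neg_mul, mul_assoc]

/-- Low frequencies are compared with the Gaussian after scaling; high frequencies are
exponentially small because the symbol is bounded below there. -/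
theorem IsKernel.tendsto_integral_profileError (hJ : IsKernel J) (hFc : Continuous F)
    (hF : MemLp F 2) {B : ℝ} (hB : ∀ ξ, ‖F ξ‖ ≤ B) :
    Tendsto (fun t : ℝ => √t * ∫ ξ, ‖profileError J F t ξ‖) atTop (𝓝 0) := by
  obtain ⟨c, δ, hc, hδ, hcδ⟩ := hJ.exists_symbol_ge_sq
  obtain ⟨κ, hκ, hκ1, hκδ⟩ := hJ.exists_symbol_ge hδ
  have hB0 : 0 ≤ B := (norm_nonneg _).trans (hB 0)
  have hA := hJ.diffusivity_pos
  have hs := hJ.continuous_symbol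
  have hpi := Real.pi_pos
  set K := ∫ ξ, |1 - symbol J ξ| * ‖F ξ‖
  have hlow := hJ.tendsto_low_frequency hFc hB hc hδ hcδ
  set low : ℝ → ℝ → ℂ := fun t ξ => (Icc (-δ) δ).indicator
      (fun ξ => (Real.exp (-(t * symbol J ξ)) : ℂ) * F ξ) ξ -
        (Real.exp (-(4 * Real.pi ^ 2 * diffusivity J * t * ξ ^ 2)) : ℂ) * F 0
  have hlim := (hlow.add ((tendsto_sqrt_mul_exp_neg one_pos 0).mul_const (2 * δ * B))).add
    ((tendsto_sqrt_mul_exp_neg hκ 1).mul_const K)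
  simp only [zero_mul, add_zero] at hlim
  refine squeeze_zero' (Eventually.of_forall fun t => by positivity) ?_ hlim
  filter_upwards [eventually_gt_atTop 0] with t ht
  have hi1 : Integrable fun ξ => ‖low t ξ‖ := by
    refine (Integrable.sub ?_ (integrable_exp_neg_mul_sq_mul (by positivity) _)).norm
    refine IntegrableOn.integrable_indicator ?_ measurableSet_Icc
    exact (Continuous.continuousOn (by fun_prop)).integrableOn_compact isCompact_Icc
  have hi2 : Integrable ((Icc (-δ) δ).indicator fun _ => Real.exp (-t) * B) :=
    (integrableOn_const (by simp)).integrable_indicator measurableSet_Icc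
  have hi3 : Integrable fun ξ => t * Real.exp (-(κ * t)) * (|1 - symbol J ξ| * ‖F ξ‖) :=
    (hJ.integrable_one_sub_symbol_mul hF).const_mul _
  have hpt : ∀ ξ, ‖profileError J F t ξ‖ ≤ ‖low t ξ‖ +
      (Icc (-δ) δ).indicator (fun _ => Real.exp (-t) * B) ξ +
        t * Real.exp (-(κ * t)) * (|1 - symbol J ξ| * ‖F ξ‖) := by
    intro ξ
    by_cases hξ : ξ ∈ Icc (-δ) δ
    · have h1 : profileError J F t ξ = low t ξ - (Real.exp (-t) : ℂ) * F ξ := by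
        simp only [low, profileError, indicator_of_mem hξ]
        push_cast; ring
      rw [h1, indicator_of_mem hξ]
      have h2 : ‖(Real.exp (-t) : ℂ) * F ξ‖ ≤ Real.exp (-t) * B := by
        rw [norm_mul, Complex.norm_real, Real.norm_of_nonneg (Real.exp_pos _).le]
        gcongr
        exact hB ξ
      have h3 : 0 ≤ t * Real.exp (-(κ * t)) * (|1 - symbol J ξ| * ‖F ξ‖) := by positivity
      linarith [norm_sub_le (low t ξ) ((Real.exp (-t) : ℂ) * F ξ)]
    · have h1 : profileError J F t ξ = low t ξ +
          ((Real.exp (-(t * symbol J ξ)) - Real.exp (-t) : ℝ) : ℂ) * F ξ := by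
        simp only [low, profileError, indicator_of_notMem hξ]
        ring
      have hξ' : δ ≤ |ξ| := by
        by_contra! h
        exact hξ (abs_le.1 h.le)
      rw [h1, indicator_of_notMem hξ, add_zero]
      refine (norm_add_le _ _).trans (add_le_add le_rfl ?_)
      rw [norm_mul, Complex.norm_real, Real.norm_eq_abs, ← mul_assoc]
      gcongr
      exact abs_exp_symbol_sub_le hκ1 (hκδ ξ hξ') ht.le
  have hint : ∫ ξ, ‖profileError J F t ξ‖ ≤ (∫ ξ, ‖low t ξ‖) + Real.exp (-t) * B * (2 * δ) +
      t * Real.exp (-(κ * t)) * K := by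
    refine (integral_mono (hJ.integrable_profileError hFc hF ht).norm
      ((hi1.add hi2).add hi3) hpt).trans_eq ?_
    rw [integral_add' (hi1.add hi2) hi3, integral_add' hi1 hi2, integral_const_mul,
      integral_indicator_const _ measurableSet_Icc]
    simp only [Measure.real, Real.volume_Icc, smul_eq_mul]
    rw [ENNReal.toReal_ofReal (by linarith)]
    ring
  refine (mul_le_mul_of_nonneg_left hint (Real.sqrt_nonneg t)).trans_eq ?_
  simp only [pow_zero, one_mul, pow_one]
  ring

end

section

open FourierTransform

/-! ### The heat kernel -/

lemma heatKernel_nonneg (s x : ℝ) : 0 ≤ heatKernel s x := by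
  unfold heatKernel; positivity

lemma integrable_heatKernel {s : ℝ} (hs : 0 < s) : Integrable (heatKernel s) := by
  have h := (integrable_exp_neg_mul_sq (b := 1 / (4 * s)) (by positivity)).const_mul
    (1 / √(4 * Real.pi * s))
  refine h.congr (ae_of_all _ fun x => ?_)
  simp only [heatKernel]
  congr 2
  field_simp

lemma realFourier_heatKernel {s : ℝ} (hs : 0 < s) (ξ : ℝ) :
    realFourier (heatKernel s) ξ = (Real.exp (-(4 * Real.pi ^ 2 * s * ξ ^ 2)) : ℂ) := by
  have hpi := Real.pi_pos
  have hpi' : (Real.pi : ℂ) ≠ 0 := Complex.ofReal_ne_zero.2 hpi.ne'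
  have hs' : (s : ℂ) ≠ 0 := Complex.ofReal_ne_zero.2 hs.ne'
  set b : ℝ := 1 / (4 * Real.pi * s) with hb
  have hb0 : 0 < b := by positivity
  have h1 : (fun x => (heatKernel s x : ℂ)) =
      fun x : ℝ => ((√b : ℝ) : ℂ) • Complex.exp (-Real.pi * (b : ℂ) * x ^ 2) := by
    funext x
    rw [heatKernel, hb, Real.sqrt_div zero_le_one, Real.sqrt_one, smul_eq_mul]
    push_cast
    congr 2
    field_simp
  have h2 : 𝓕 (fun x : ℝ => Complex.exp (-Real.pi * (b : ℂ) * x ^ 2)) ξ =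
      1 / (b : ℂ) ^ (1 / 2 : ℂ) * Complex.exp (-Real.pi / b * ξ ^ 2) :=
    congrFun (fourier_gaussian_pi (b := b) (by simpa using hb0)) ξ
  have h3 : (b : ℂ) ^ (1 / 2 : ℂ) = ((√b : ℝ) : ℂ) := by
    rw [Real.sqrt_eq_rpow, Complex.ofReal_cpow hb0.le]; norm_num
  have h4 : ((√b : ℝ) : ℂ) ≠ 0 := Complex.ofReal_ne_zero.2 (Real.sqrt_pos.2 hb0).ne'
  rw [realFourier, h1, Real.fourier_real_eq]
  simp_rw [smul_comm _ ((√b : ℝ) : ℂ)]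
  rw [integral_smul, ← Real.fourier_real_eq, h2, h3, smul_eq_mul, ← mul_assoc, mul_one_div_cancel h4,
    one_mul, Complex.ofReal_exp]
  congr 1
  rw [hb]
  push_cast
  field_simp

lemma integral_heatKernel {s : ℝ} (hs : 0 < s) : ∫ x, heatKernel s x = 1 := by
  have h := realFourier_heatKernel hs 0
  rw [realFourier_zero] at h
  simpa using h

lemma sqrt_heatKernel (s x : ℝ) : √(heatKernel s x) =
    √(1 / √(4 * Real.pi * s)) * Real.exp (-(1 / (8 * s)) * x ^ 2) := by
  rw [heatKernel, Real.sqrt_mul (by positivity), ← Real.exp_half]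
  congr 2
  ring

lemma integrable_sqrt_heatKernel {s : ℝ} (hs : 0 < s) :
    Integrable fun x => √(heatKernel s x) := by
  simp_rw [sqrt_heatKernel]
  exact (integrable_exp_neg_mul_sq (by positivity)).const_mul _

lemma integral_sqrt_heatKernel {s : ℝ} (hs : 0 < s) :
    ∫ x, √(heatKernel s x) = √(√(16 * Real.pi * s)) := by
  have hpi := Real.pi_pos
  simp_rw [sqrt_heatKernel]
  rw [integral_const_mul, integral_gaussian, ← Real.sqrt_mul (by positivity)]
  congr 1
  have h : Real.pi / (1 / (8 * s)) = √(4 * Real.pi * s) * √(16 * Real.pi * s) := by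
    rw [← Real.sqrt_mul (by positivity), show 4 * Real.pi * s * (16 * Real.pi * s) =
      (8 * Real.pi * s) ^ 2 by ring, Real.sqrt_sq (by positivity)]
    field_simp
  rw [h, ← mul_assoc, one_div_mul_cancel (by positivity), one_mul]

/-! ### Convergence in `L^∞` and in `L¹` -/

variable {J u₀ : ℝ → ℝ} {u : ℝ → Lp ℝ 1 (volume : Measure ℝ)}

/-- Comparing Fourier transforms bounds the error, once the part `exp(-t) u₀` that is never smoothed
has been removed from `u(t)`. -/
lemma IsKernel.ae_abs_sub_le (hJ : IsKernel J) (hu₀ : Integrable u₀) (hu₀2 : MemLp u₀ 2)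
    (hu : IsSolution J u₀ u) {t : ℝ} (ht : 0 < t) :
    ∀ᵐ x, |u t x - Real.exp (-t) * u₀ x - (∫ y, u₀ y) * heatKernel (diffusivity J * t) x| ≤
      ∫ ξ, ‖profileError J (realFourier u₀) t ξ‖ := by
  have hs : 0 < diffusivity J * t := mul_pos hJ.diffusivity_pos ht
  have hut := L1.integrable_coeFn (u t)
  have h1 := hut.sub (hu₀.const_mul (Real.exp (-t)))
  have h2 := (integrable_heatKernel hs).const_mul (∫ y, u₀ y)
  have hF : realFourier (fun x => u t x - Real.exp (-t) * u₀ x -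
      (∫ y, u₀ y) * heatKernel (diffusivity J * t) x) =
      profileError J (realFourier u₀) t := by
    funext ξ
    refine (realFourier_sub h1 h2 ξ).trans ?_
    have h3 := realFourier_sub hut (hu₀.const_mul (Real.exp (-t))) ξ
    refine (congrArg₂ _ h3 rfl).trans ?_
    rw [realFourier_const_mul, realFourier_const_mul, realFourier_heatKernel hs,
      hu.realFourier_eq hJ.integrable hJ.integral_eq_one ξ ht.le, hJ.realFourier_eq,
      profileError, realFourier_zero]
    have h4 : Complex.exp (t * (((1 - symbol J ξ : ℝ) : ℂ) - 1)) =
        (Real.exp (-(t * symbol J ξ)) : ℂ) := by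
      rw [Complex.ofReal_exp]; congr 1; push_cast; ring
    rw [h4, show 4 * Real.pi ^ 2 * (diffusivity J * t) * ξ ^ 2 =
      4 * Real.pi ^ 2 * diffusivity J * t * ξ ^ 2 by ring]
    push_cast; ring
  have hi : Integrable (profileError J (realFourier u₀) t) :=
    hJ.integrable_profileError (continuous_realFourier hu₀)
      (memLp_two_fourier hu₀.ofReal hu₀2.ofReal) ht
  have := ae_norm_le_integral_fourier (h1.sub h2).ofReal (f := fun x =>
    ((u t x - Real.exp (-t) * u₀ x -
      (∫ y, u₀ y) * heatKernel (diffusivity J * t) x : ℝ) : ℂ)) (by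
      rw [← hF] at hi; exact hi)
  filter_upwards [this] with x hx
  rw [Complex.norm_real, Real.norm_eq_abs] at hx
  refine hx.trans_eq ?_
  rw [← hF]
  rfl

lemma IsKernel.tendsto_profileError (hJ : IsKernel J) (hu₀ : Integrable u₀) (hu₀2 : MemLp u₀ 2) :
    Tendsto (fun t : ℝ => √t * ∫ ξ, ‖profileError J (realFourier u₀) t ξ‖) atTop (𝓝 0) :=
  hJ.tendsto_integral_profileError (continuous_realFourier hu₀)
    (memLp_two_fourier hu₀.ofReal hu₀2.ofReal) (norm_realFourier_le u₀)

lemma integral_le_add_of_ae_le {f g h : ℝ → ℝ} (hf : Integrable f) (hg : Integrable g)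
    (hh : Integrable h) (H : ∀ᵐ x, f x ≤ g x + h x) : ∫ x, f x ≤ (∫ x, g x) + ∫ x, h x := by
  rw [← integral_add hg hh]
  exact integral_mono_ae hf (hg.add hh) H

/-- A quantitative form of Scheffé's lemma: if `g ≥ 0` and the `L¹` norm of `f` hardly exceeds that
of `g`, then uniform closeness of `f` and `g` implies closeness in `L¹`. -/
lemma integral_abs_sub_le_of_ae_le {f g : ℝ → ℝ} (hf : Integrable f) (hg : Integrable g)
    (hg0 : ∀ x, 0 ≤ g x) (hgs : Integrable fun x => √(g x)) {ε : ℝ}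
    (h : ∀ᵐ x, |f x - g x| ≤ ε) :
    ∫ x, |f x - g x| ≤ (∫ x, |f x|) - (∫ x, g x) + 2 * √ε * ∫ x, √(g x) := by
  rw [← integral_sub hf.abs hg, ← integral_const_mul]
  refine integral_le_add_of_ae_le (hf.sub hg).abs (hf.abs.sub hg) (hgs.const_mul _) ?_
  filter_upwards [h] with x hx
  have hg1 := hg0 x
  -- `g + |f - g| - |f|` is at most `2 g` and at most `2 |f - g|`, hence at most `2 √(g ε)`.
  have h1 : min (g x) |f x - g x| ≤ √ε * √(g x) := by
    rw [← Real.sqrt_mul ((abs_nonneg _).trans hx)]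
    refine Real.le_sqrt_of_sq_le ?_
    rw [sq, mul_comm ε]
    exact mul_le_mul (min_le_left _ _) ((min_le_right _ _).trans hx)
      (le_min hg1 (abs_nonneg _)) hg1
  have h2 : g x + |f x - g x| - |f x| ≤ 2 * min (g x) |f x - g x| := by
    rw [mul_min_of_nonneg _ _ zero_le_two]
    refine le_min ?_ ?_
    · have := abs_sub (f x) (g x)
      rw [abs_of_nonneg hg1] at this
      linarith
    · have := abs_sub_abs_le_abs_sub (g x) (f x)
      rw [abs_of_nonneg hg1, abs_sub_comm] at this
      linarith
  linarith

lemma IsKernel.isSolution_exp (hJ : IsKernel J) (hu₀ : Integrable u₀) : IsSolution J u₀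
    (fun t => NormedSpace.exp (t • generator J hJ.integrable) (hu₀.toL1 u₀)) :=
  have h := NonlocalDiffusion.isSolution_exp hJ.integrable hJ.integral_eq_one (hu₀.toL1 u₀)
  ⟨h.continuousOn, h.initial.trans hu₀.coeFn_toL1, h.equation⟩

lemma IsKernel.integral_abs_solution_le (hJ : IsKernel J)
    (hu : IsSolution J u₀ u) {t : ℝ} (ht : 0 ≤ t) : ∫ x, |u t x| ≤ ∫ x, |u₀ x| := by
  have h0 : u 0 =ᵐ[volume] u₀ := hu.initial
  have hexp := NonlocalDiffusion.isSolution_exp hJ.integrable hJ.integral_eq_one (u 0)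
  have hu' : IsSolution J (u 0) u := ⟨hu.continuousOn, ae_eq_rfl, hu.equation⟩
  have h1 := hu'.unique hJ.integrable hJ.integral_eq_one hexp ht
  have h2 : ‖u t‖ ≤ ‖u 0‖ := by
    rw [h1]
    refine (ContinuousLinearMap.le_opNorm _ _).trans (mul_le_of_le_one_left (norm_nonneg _) ?_)
    exact norm_exp_generator_le hJ.integrable hJ.nonneg hJ.integral_eq_one ht
  rw [L1.norm_eq_integral_norm, L1.norm_eq_integral_norm] at h2
  refine h2.trans_eq (integral_congr_ae ?_)
  filter_upwards [h0] with x hx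
  rw [hx, Real.norm_eq_abs]

/-- For nonnegative data the `L¹` norm is bounded by the mass `M`, and Scheffé's lemma upgrades
uniform convergence to convergence in `L¹`. -/
lemma IsKernel.tendsto_integral_abs_of_nonneg (hJ : IsKernel J) (hu₀ : Integrable u₀)
    (hu₀2 : MemLp u₀ 2) (hpos : ∀ x, 0 ≤ u₀ x) (hu : IsSolution J u₀ u) :
    Tendsto (fun t => ∫ x, |u t x - (∫ y, u₀ y) * heatKernel (diffusivity J * t) x|)
      atTop (𝓝 0) := by
  have hA := hJ.diffusivity_pos
  have hpi := Real.pi_pos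
  set M := ∫ y, u₀ y
  have hM0 : 0 ≤ M := integral_nonneg hpos
  set ε : ℝ → ℝ := fun t => ∫ ξ, ‖profileError J (realFourier u₀) t ξ‖
  have hlimε : Tendsto (fun t : ℝ => √t * ε t) atTop (𝓝 0) := hJ.tendsto_profileError hu₀ hu₀2
  have hexp : Tendsto (fun t : ℝ => Real.exp (-t)) atTop (𝓝 0) :=
    Real.tendsto_exp_neg_atTop_nhds_zero
  have hlim : Tendsto (fun t : ℝ => 2 * M * Real.exp (-t) +
      2 * √M * √(√(16 * Real.pi * diffusivity J)) * √(√t * ε t)) atTop (𝓝 0) := by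
    simpa using (hexp.const_mul (2 * M)).add
      (((Real.continuous_sqrt.tendsto 0).comp hlimε).const_mul
        (2 * √M * √(√(16 * Real.pi * diffusivity J))))
  refine squeeze_zero' (Eventually.of_forall fun t => integral_nonneg fun _ => abs_nonneg _) ?_ hlim
  filter_upwards [eventually_gt_atTop 0] with t ht
  have hs : 0 < diffusivity J * t := mul_pos hA ht
  have hut := L1.integrable_coeFn (u t)
  have he := hu₀.const_mul (Real.exp (-t))
  have hg := (integrable_heatKernel hs).const_mul M
  have hsq : ∀ x, √(M * heatKernel (diffusivity J * t) x) =
      √M * √(heatKernel (diffusivity J * t) x) := fun x => Real.sqrt_mul hM0 _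
  have h1 := integral_abs_sub_le_of_ae_le (hut.sub he) hg
    (fun x => mul_nonneg hM0 (heatKernel_nonneg _ _))
    (by simp_rw [hsq]; exact (integrable_sqrt_heatKernel hs).const_mul _)
    (hJ.ae_abs_sub_le hu₀ hu₀2 hu ht)
  have h_abs : ∫ x, |Real.exp (-t) * u₀ x| = Real.exp (-t) * M := by
    simp_rw [abs_mul, abs_of_nonneg (Real.exp_pos _).le, abs_of_nonneg (hpos _)]
    rw [integral_const_mul]
  have h2 : ∫ x, |(⇑(u t) - fun x => Real.exp (-t) * u₀ x) x| ≤ M + Real.exp (-t) * M := by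
    have h3 := hJ.integral_abs_solution_le hu ht.le
    simp_rw [abs_of_nonneg (hpos _)] at h3
    calc _ ≤ ∫ x, (|u t x| + |Real.exp (-t) * u₀ x|) :=
          integral_mono (hut.sub he).abs (hut.abs.add he.abs) fun x => abs_sub _ _
      _ = (∫ x, |u t x|) + Real.exp (-t) * M := by rw [integral_add hut.abs he.abs, h_abs]
      _ ≤ _ := by gcongr
  have h4 : ∫ x, |u t x - M * heatKernel (diffusivity J * t) x| ≤
      (∫ x, |(⇑(u t) - fun x => Real.exp (-t) * u₀ x) x -
        M * heatKernel (diffusivity J * t) x|) + Real.exp (-t) * M := by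
    rw [← h_abs]
    refine integral_le_add_of_ae_le (hut.sub hg).abs ((hut.sub he).sub hg).abs he.abs
      (ae_of_all _ fun x => ?_)
    simp only [Pi.sub_apply]
    refine le_of_eq_of_le ?_ (abs_add_le _ _)
    congr 1; ring
  simp_rw [hsq] at h1
  rw [integral_const_mul, integral_const_mul, integral_heatKernel hs,
    integral_sqrt_heatKernel hs] at h1
  have h5 : 2 * √(ε t) * (√M * √(√(16 * Real.pi * (diffusivity J * t)))) =
      2 * √M * √(√(16 * Real.pi * diffusivity J)) * √(√t * ε t) := by
    rw [← mul_assoc (16 * Real.pi), Real.sqrt_mul (by positivity) t,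
      Real.sqrt_mul (by positivity) √t, Real.sqrt_mul (by positivity) (ε t)]
    ring
  rw [h5] at h1
  linarith

/-- Signed data are split into positive and negative parts, the evolution being linear. -/
lemma IsKernel.tendsto_integral_abs (hJ : IsKernel J) (hu₀ : Integrable u₀)
    (hu₀2 : MemLp u₀ 2) (hu : IsSolution J u₀ u) :
    Tendsto (fun t => ∫ x, |u t x - (∫ y, u₀ y) * heatKernel (diffusivity J * t) x|)
      atTop (𝓝 0) := by
  have hp := hu₀.pos_part
  have hn := hu₀.neg_part
  have hlp := hJ.tendsto_integral_abs_of_nonneg hp hu₀2.pos_part (fun _ => le_max_right _ _)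
    (hJ.isSolution_exp hp)
  have hln := hJ.tendsto_integral_abs_of_nonneg hn hu₀2.neg_part (fun _ => le_max_right _ _)
    (hJ.isSolution_exp hn)
  have hlim := hlp.add hln
  rw [add_zero] at hlim
  have hparts : ∀ x, u₀ x = max (u₀ x) 0 - max (-u₀ x) 0 := fun x =>
    (max_zero_sub_max_neg_zero_eq_self (u₀ x)).symm
  have hM : ∫ y, u₀ y = (∫ y, max (u₀ y) 0) - ∫ y, max (-u₀ y) 0 := by
    rw [← integral_sub hp hn]; exact integral_congr_ae (ae_of_all _ hparts)
  have hL1 : hu₀.toL1 u₀ = hp.toL1 _ - hn.toL1 _ := by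
    rw [← Integrable.toL1_sub, Integrable.toL1_eq_toL1_iff]
    exact ae_of_all _ hparts
  refine squeeze_zero' (Eventually.of_forall fun t => integral_nonneg fun _ => abs_nonneg _) ?_ hlim
  filter_upwards [eventually_gt_atTop 0] with t ht
  have hs : 0 < diffusivity J * t := mul_pos hJ.diffusivity_pos ht
  have hG := integrable_heatKernel hs
  have hut := hu.unique hJ.integrable hJ.integral_eq_one (hJ.isSolution_exp hu₀) ht.le
  simp only [hL1, map_sub] at hut
  refine integral_le_add_of_ae_le ((L1.integrable_coeFn _).sub (hG.const_mul _)).abs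
    ((L1.integrable_coeFn _).sub (hG.const_mul _)).abs
    ((L1.integrable_coeFn _).sub (hG.const_mul _)).abs ?_
  rw [hut]
  filter_upwards [Lp.coeFn_sub
    (NormedSpace.exp (t • generator J hJ.integrable) (hp.toL1 fun x => max (u₀ x) 0))
    (NormedSpace.exp (t • generator J hJ.integrable) (hn.toL1 fun x => max (-u₀ x) 0))] with x hx
  rw [hx, hM]
  simp only [Pi.sub_apply]
  refine le_of_eq_of_le ?_ (abs_sub _ _)
  congr 1; ring

/-! ### Interpolation and the conclusion -/

/-- Interpolation of the `L^p` norm between `L¹` and `L^∞`. -/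
lemma eLpNorm_le_rpow_mul_rpow {f : ℝ → ℝ} (hf : AEStronglyMeasurable f volume) {p : ℝ≥0∞}
    (hp : 1 ≤ p) : eLpNorm f p volume ≤ eLpNorm f 1 volume ^ (1 / p).toReal *
      eLpNorm f ⊤ volume ^ (1 - (1 / p).toReal) := by
  rcases eq_or_ne p ⊤ with rfl | hpt
  · simp
  have hq : 1 ≤ p.toReal := by
    rw [← ENNReal.toReal_one]; exact ENNReal.toReal_mono hpt hp
  have hq0 : 0 < p.toReal := one_pos.trans_le hq
  have hp0 : p ≠ 0 := (one_pos.trans_le hp).ne'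
  set N := eLpNorm f ⊤ volume with hN
  have h1 : ∫⁻ x, ‖f x‖ₑ ^ p.toReal ≤ eLpNorm f 1 volume * N ^ (p.toReal - 1) := by
    rw [eLpNorm_one_eq_lintegral_enorm, ← lintegral_mul_const'' _ hf.enorm]
    refine lintegral_mono_ae ?_
    filter_upwards [enorm_ae_le_eLpNormEssSup f volume] with x hx
    calc ‖f x‖ₑ ^ p.toReal = ‖f x‖ₑ ^ (1 + (p.toReal - 1)) := by congr 1; ring
      _ = ‖f x‖ₑ * ‖f x‖ₑ ^ (p.toReal - 1) := by
          rw [ENNReal.rpow_add_of_nonneg _ _ zero_le_one (by linarith), ENNReal.rpow_one]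
      _ ≤ _ := by
          rw [hN, eLpNorm_exponent_top]
          gcongr
  rw [eLpNorm_eq_lintegral_rpow_enorm_toReal hp0 hpt]
  refine (ENNReal.rpow_le_rpow h1 (by positivity)).trans_eq ?_
  rw [ENNReal.mul_rpow_of_nonneg _ _ (by positivity), ← ENNReal.rpow_mul, one_div p,
    ENNReal.toReal_inv, one_div]
  congr 2
  field_simp

lemma memLp_two_of_memLp_one_top {f : ℝ → ℝ} (h1 : MemLp f 1) (htop : MemLp f ⊤) : MemLp f 2 := by
  refine ⟨h1.1, (eLpNorm_le_rpow_mul_rpow h1.1 one_le_two).trans_lt ?_⟩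
  have h : (1 / 2 : ℝ≥0∞).toReal = 1 / 2 := by simp
  rw [h]
  exact ENNReal.mul_lt_top (ENNReal.rpow_lt_top_of_nonneg (by norm_num) h1.2.ne)
    (ENNReal.rpow_lt_top_of_nonneg (by norm_num) htop.2.ne)

lemma IsKernel.tendsto_eLpNorm_top (hJ : IsKernel J) (hu₀ : Integrable u₀) (hu₀2 : MemLp u₀ 2)
    (hu₀_top : MemLp u₀ ⊤) (hu : IsSolution J u₀ u) :
    Tendsto (fun t => ENNReal.ofReal √t * eLpNorm
      (fun x => u t x - (∫ y, u₀ y) * heatKernel (diffusivity J * t) x) ⊤ volume) atTop (𝓝 0) := by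
  set B := (eLpNorm u₀ ⊤ volume).toReal
  have hB : ∀ᵐ x, |u₀ x| ≤ B := by
    filter_upwards [enorm_ae_le_eLpNormEssSup u₀ volume] with x hx
    rw [← Real.norm_eq_abs, ← toReal_enorm]
    exact ENNReal.toReal_mono hu₀_top.2.ne hx
  have hlim : Tendsto (fun t : ℝ => ENNReal.ofReal
      (√t * (∫ ξ, ‖profileError J (realFourier u₀) t ξ‖) + √t * (t ^ 0 * Real.exp (-(1 * t))) * B))
      atTop (𝓝 0) := by
    have h := ENNReal.tendsto_ofReal ((hJ.tendsto_profileError hu₀ hu₀2).add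
      ((tendsto_sqrt_mul_exp_neg one_pos 0).mul_const B))
    simpa only [zero_mul, add_zero, ENNReal.ofReal_zero] using h
  refine tendsto_of_tendsto_of_tendsto_of_le_of_le' tendsto_const_nhds hlim
    (Eventually.of_forall fun _ => zero_le) ?_
  filter_upwards [eventually_gt_atTop 0] with t ht
  have h : eLpNorm (fun x => u t x - (∫ y, u₀ y) * heatKernel (diffusivity J * t) x) ⊤ volume ≤
      ENNReal.ofReal ((∫ ξ, ‖profileError J (realFourier u₀) t ξ‖) + Real.exp (-t) * B) := by
    rw [eLpNorm_exponent_top]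
    refine eLpNormEssSup_le_of_ae_bound ?_
    filter_upwards [hJ.ae_abs_sub_le hu₀ hu₀2 hu ht, hB] with x hx hBx
    rw [Real.norm_eq_abs]
    calc _ = |(u t x - Real.exp (-t) * u₀ x -
            (∫ y, u₀ y) * heatKernel (diffusivity J * t) x) + Real.exp (-t) * u₀ x| := by
          congr 1; ring
      _ ≤ _ := by
          refine (abs_add_le _ _).trans (add_le_add hx ?_)
          rw [abs_mul, abs_of_pos (Real.exp_pos _)]
          gcongr
  refine (mul_le_mul_right h _).trans_eq ?_
  rw [← ENNReal.ofReal_mul (Real.sqrt_nonneg _)]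
  congr 1
  rw [pow_zero, one_mul, one_mul]
  ring

theorem IsKernel.tendsto_eLpNorm (hJ : IsKernel J) (hu₀_one : MemLp u₀ 1) (hu₀_top : MemLp u₀ ⊤)
    (hu : IsSolution J u₀ u) {p : ℝ≥0∞} (hp : 1 ≤ p) :
    Tendsto (fun t : ℝ => ENNReal.ofReal (t ^ ((1 / 2 : ℝ) * (1 - (1 / p).toReal))) *
      eLpNorm (fun x => u t x - (∫ y, u₀ y) * heatKernel (diffusivity J * t) x) p volume)
      atTop (𝓝 0) := by
  have hu₀ : Integrable u₀ := memLp_one_iff_integrable.1 hu₀_one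
  have hu₀2 := memLp_two_of_memLp_one_top hu₀_one hu₀_top
  set D : ℝ → ℝ → ℝ := fun t x => u t x - (∫ y, u₀ y) * heatKernel (diffusivity J * t) x
  have hD : ∀ t, 0 < t → Integrable (D t) := fun t ht => (L1.integrable_coeFn (u t)).sub
    ((integrable_heatKernel (mul_pos hJ.diffusivity_pos ht)).const_mul _)
  have htop := hJ.tendsto_eLpNorm_top hu₀ hu₀2 hu₀_top hu
  have hone : Tendsto (fun t => eLpNorm (D t) 1 volume) atTop (𝓝 0) := by
    have h := ENNReal.tendsto_ofReal (hJ.tendsto_integral_abs hu₀ hu₀2 hu)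
    rw [ENNReal.ofReal_zero] at h
    refine h.congr' ?_
    filter_upwards [eventually_gt_atTop 0] with t ht
    rw [eLpNorm_one_eq_lintegral_enorm, ← ofReal_integral_norm_eq_lintegral_enorm (hD t ht)]
    rfl
  set α := (1 / p).toReal with hα
  have hα0 : 0 ≤ α := ENNReal.toReal_nonneg
  have hα1 : α ≤ 1 := by
    rw [hα, ← ENNReal.toReal_one]
    exact ENNReal.toReal_mono ENNReal.one_ne_top (by simpa using hp)
  have hlim : Tendsto (fun t => eLpNorm (D t) 1 volume ^ α *
      (ENNReal.ofReal √t * eLpNorm (D t) ⊤ volume) ^ (1 - α)) atTop (𝓝 0) := by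
    have h1 := ((ENNReal.continuous_rpow_const (y := α)).tendsto 0).comp hone
    have h2 := ((ENNReal.continuous_rpow_const (y := 1 - α)).tendsto 0).comp htop
    have h0 : ∀ r : ℝ, 0 ≤ r → (0 : ℝ≥0∞) ^ r ≠ ⊤ := fun r hr =>
      ENNReal.rpow_ne_top_of_nonneg hr ENNReal.zero_ne_top
    have h3 := ENNReal.Tendsto.mul h1 (Or.inr (h0 _ (sub_nonneg.2 hα1))) h2 (Or.inr (h0 _ hα0))
    -- The exponents `α` and `1 - α` are not both zero.
    have h4 : (0 : ℝ≥0∞) ^ α * 0 ^ (1 - α) = 0 := by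
      rcases hα0.eq_or_lt with h | h
      · rw [← h]; simp
      · rw [ENNReal.zero_rpow_of_pos h, zero_mul]
    rwa [h4] at h3
  refine tendsto_of_tendsto_of_tendsto_of_le_of_le' tendsto_const_nhds hlim
    (Eventually.of_forall fun _ => zero_le) ?_
  filter_upwards [eventually_gt_atTop 0] with t ht
  have ht' : ENNReal.ofReal (t ^ ((1 / 2 : ℝ) * (1 - α))) = ENNReal.ofReal √t ^ (1 - α) := by
    rw [ENNReal.ofReal_rpow_of_nonneg (Real.sqrt_nonneg t) (sub_nonneg.2 hα1),
      Real.sqrt_eq_rpow, ← Real.rpow_mul ht.le]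
  rw [ht', ENNReal.mul_rpow_of_nonneg _ _ (sub_nonneg.2 hα1), mul_left_comm]
  exact mul_le_mul_right (eLpNorm_le_rpow_mul_rpow (hD t ht).1 hp) _

lemma isKernel_of_rapidlyDecaying (hJ_nonneg : ∀ x, 0 ≤ J x) (hJ_cont : Continuous J)
    (hJ_even : ∀ x, J (-x) = J x) (hJ_decay : RapidlyDecaying J) (hJ_int : ∫ x, J x = 1) :
    IsKernel J := by
  have hmom : ∀ k : ℕ, Integrable fun x => J x * x ^ k := by
    intro k
    obtain ⟨C₀, hC₀⟩ := hJ_decay k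
    obtain ⟨C₂, hC₂⟩ := hJ_decay (k + 2)
    refine (integrable_inv_one_add_sq.const_mul (C₀ + C₂)).mono'
      (Continuous.aestronglyMeasurable (by fun_prop)) (ae_of_all _ fun x => ?_)
    rw [← div_eq_mul_inv, le_div_iff₀ (by positivity), norm_mul, norm_pow, Real.norm_eq_abs,
      Real.norm_eq_abs]
    have h0 := hC₀ x
    have h2 := hC₂ x
    rw [pow_add, sq_abs] at h2
    nlinarith
  have hi : Integrable J := by simpa using hmom 0
  obtain ⟨C, hC⟩ := hJ_decay 0
  have htop : MemLp J ⊤ := memLp_top_of_bound hi.1 C (ae_of_all _ fun x => by simpa using hC x)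
  exact ⟨hJ_nonneg, hJ_even, hi, hJ_int,
    memLp_two_of_memLp_one_top (memLp_one_iff_integrable.2 hi) htop, hmom 2, hmom 4⟩

end

end NonlocalDiffusion

end

theorem theorem1 (J : ℝ → ℝ)
    (hJ_nonneg : ∀ x, 0 ≤ J x)
    (hJ_smooth : ContDiff ℝ ∞ J)
    (hJ_even : ∀ x, J (-x) = J x)
    (hJ_decay : NonlocalDiffusion.RapidlyDecaying J)
    (hJ_int : ∫ x, J x = 1)
    (u₀ : ℝ → ℝ)
    (hu₀_one : MemLp u₀ 1 volume)
    (hu₀_top : MemLp u₀ ⊤ volume) :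
    (∃ u, NonlocalDiffusion.IsSolution J u₀ u) ∧
    (∀ u v, NonlocalDiffusion.IsSolution J u₀ u → NonlocalDiffusion.IsSolution J u₀ v →
      EqOn u v (Ici 0)) ∧
    ∀ u, NonlocalDiffusion.IsSolution J u₀ u → ∀ p : ℝ≥0∞, 1 ≤ p →
      Tendsto
        (fun t : ℝ => ENNReal.ofReal (t ^ ((1 / 2 : ℝ) * (1 - (1 / p).toReal))) *
          eLpNorm
            (fun x : ℝ => u t x -
              (∫ y, u₀ y) *
                NonlocalDiffusion.heatKernel (((1 / 2 : ℝ) * ∫ z, J z * z ^ 2) * t) x)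
            p volume)
        atTop (𝓝 0) := by
  have hJ := NonlocalDiffusion.isKernel_of_rapidlyDecaying hJ_nonneg hJ_smooth.continuous hJ_even
    hJ_decay hJ_int
  have hu₀ : Integrable u₀ := memLp_one_iff_integrable.1 hu₀_one
  exact ⟨⟨_, hJ.isSolution_exp hu₀⟩,
    fun u v hu hv t ht => hu.unique hJ.integrable hJ_int hv ht,
    fun u hu p hp => hJ.tendsto_eLpNorm hu₀_one hu₀_top hu hp⟩
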